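/- Let $n\ge 2$ and let $L_1\ge L_2\ge\dots\ge L_n>0$ be real numbers. A utility set with maximum utilities $L=(L_1,\dots,L_n)$ is a compact convex set $U\subseteq\mathbb{R}^n_{\ge 0}$ such that $\max\{u_i : u\in U\}=L_i$ for every $i$. A utilitarian solution $u^*$ of $U$ is a maximizer of $\sum_{i=1}^n u_i$ over $U$. A max-min fair solution $u^{MMF}$ of $U$ is a point of $U$ at which the vector of the ratios $u_i/L_i$, arranged in non-decreasing order, is lexicographically largest over $U$. The price of max-min fairness is $$POF(U;MMF)=1-\frac{\sum_{i=1}^n u_i^{MMF}}{\sum_{i=1}^n u_i^*}.$$ Put $$S_1=\Big\{l\in\{1,\dots,n-1\}:(n-l-1)L_{l+1}<\sum_{i=1}^l L_i\le (n-l+1)L_{l+1}\Big\},$$ $$S_2=\Big\{l\in\{1,\dots,n-1\}:\sum_{i=1}^l L_i>(n-l+1)L_{l+1}\Big\}.$$ Then max-min fair and utilitarian solutions exist for every utility set $U$ with maximum utilities $L$, and the following hold. (1) If $S_1\ne\emptyset$ and $l^*=\max S_1$, then for every such $U$ $$POF(U;MMF)\le 1-\frac{4L_{l^*+1}\sum_{i=1}^n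 L_i}{\big(\sum_{i=1}^{l^*}L_i+(n-l^*+1)L_{l^*+1}\big)^2}.$$ (2) If $S_1=\emptyset$, then $S_2\neq\emptyset$, and with $l^*=\min S_2$, for every such $U$ $$POF(U;MMF)\le 1-\frac{\sum_{i=1}^n L_i}{(n-l^*+1)\sum_{i=1}^{l^*}L_i}.$$ Both bounds are tight: for every given $L$ there is a utility set $U$ with maximum utilities $L$, which can moreover be chosen monotone ($u\in U$ and $0\le v\le u$ imply $v\in U$), for which equality holds in the inequality of the case that applies. If $L_1=\dots=L_n$, then $S_1\neq\emptyset$ and the bound in (1) equals $1-\frac{4n}{(n+1)^2}$. -/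

import Mathlib

/-- Players are indexed by `Fin n`, so that player `i + 1` of the usual
one-based numbering is `i : Fin n`.  `U` is a utility set with maximum achievable utilities `L`:
a compact convex set of non-negative utility vectors such that the largest utility of player `i`
over `U` is attained and equals `L i`. -/
structure IsUtilitySet {n : ℕ} (L : Fin n → ℝ) (U : Set (Fin n → ℝ)) : Prop where
  nonneg : ∀ u ∈ U, ∀ i, 0 ≤ u i
  convex : Convex ℝ U
  compact : IsCompact U
  isGreatest : ∀ i, IsGreatest ((fun u : Fin n → ℝ => u i) '' U) (L i)

/-- Monotone utility sets: with `u` they contain every `v` such that `0 ≤ v ≤ u`. -/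
def IsMonotoneSet {n : ℕ} (U : Set (Fin n → ℝ)) : Prop :=
  ∀ u ∈ U, ∀ v : Fin n → ℝ, 0 ≤ v → v ≤ u → v ∈ U

/-- A utilitarian solution maximizes the sum of the utilities over `U`. -/
def IsUtilitarian {n : ℕ} (U : Set (Fin n → ℝ)) (w : Fin n → ℝ) : Prop :=
  w ∈ U ∧ ∀ v ∈ U, ∑ i, v i ≤ ∑ i, w i

/-- The ratios `u i / L i`, rearranged in non-decreasing order (smallest ratio first). -/
noncomputable def sortedRatios {n : ℕ} (L u : Fin n → ℝ) : Fin n → ℝ :=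
  (fun i => u i / L i) ∘ Tuple.sort (fun i => u i / L i)

/-- A max-min fair solution maximizes lexicographically over `U` the smallest ratio `u i / L i`,
then the second smallest ratio, and so on. -/
def IsMaxMinFair {n : ℕ} (L : Fin n → ℝ) (U : Set (Fin n → ℝ)) (u : Fin n → ℝ) : Prop :=
  u ∈ U ∧ ∀ v ∈ U, toLex (sortedRatios L v) ≤ toLex (sortedRatios L u)

/-- `p` is the price of max-min fairness of `U`: the relative loss of total utility of a max-min
fair solution with respect to a utilitarian solution. -/
def IsPriceOfMMF {n : ℕ} (L : Fin n → ℝ) (U : Set (Fin n → ℝ)) (p : ℝ) : Prop :=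
  ∃ u w : Fin n → ℝ, IsMaxMinFair L U u ∧ IsUtilitarian U w ∧
    p = 1 - (∑ i, u i) / (∑ i, w i)

/-- The sum of the first `l` maximum utilities. -/
def headSum {n : ℕ} (L : Fin n → ℝ) (l : Fin n) : ℝ :=
  ∑ i ∈ Finset.univ.filter (fun i => i < l), L i

/-- The set `S₁` of the `l ∈ {1, …, n - 1}` with
`(n - l - 1) L_{l+1} < L_1 + ⋯ + L_l ≤ (n - l + 1) L_{l+1}`.
In the zero-based numbering `L_{l+1}` is `L l`. -/
def indexSet₁ {n : ℕ} (L : Fin n → ℝ) : Set (Fin n) :=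
  {l | 1 ≤ (l : ℕ) ∧ ((n : ℝ) - (l : ℕ) - 1) * L l < headSum L l ∧
    headSum L l ≤ ((n : ℝ) - (l : ℕ) + 1) * L l}

/-- The set `S₂` of the `l ∈ {1, …, n - 1}` with `L_1 + ⋯ + L_l > (n - l + 1) L_{l+1}`. -/
def indexSet₂ {n : ℕ} (L : Fin n → ℝ) : Set (Fin n) :=
  {l | 1 ≤ (l : ℕ) ∧ headSum L l > ((n : ℝ) - (l : ℕ) + 1) * L l}

/-- `1 - 4 L_{l+1} ∑ L_i / (L_1 + ⋯ + L_l + (n - l + 1) L_{l+1})²`. -/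
noncomputable def mmfBound₁ {n : ℕ} (L : Fin n → ℝ) (l : Fin n) : ℝ :=
  1 - 4 * L l * (∑ i, L i) / (headSum L l + ((n : ℝ) - (l : ℕ) + 1) * L l) ^ 2

/-- `1 - ∑ L_i / ((n - l + 1) (L_1 + ⋯ + L_l))`. -/
noncomputable def mmfBound₂ {n : ℕ} (L : Fin n → ℝ) (l : Fin n) : ℝ :=
  1 - (∑ i, L i) / (((n : ℝ) - (l : ℕ) + 1) * headSum L l)

/-! ### Order statistics and lexicographic maxima -/

/-! Let `t` be the smallest ratio at a fair solution. No point of the normalized set has all ratios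
above `t`, so a hyperplane separates it from that orthant. Scaled suitably, its normal `ν` has sum
`1 / t`, and `ν i ≤ 1` because player `i` can reach ratio 1. A utilitarian point has ratios `x` with
`∑ ν x ≤ 1`, so any bound `G` on `(∑ ν) (∑ L x)` gives a utilitarian value at most `t G`; the fair
value is at least `t ∑ L` (`isBilinearBound_le`). The bilinear problem is solved by linearizing both
factors and applying AM-GM with a slope `c` (`isBilinearBound_of_slope`). The slope is `L l` in case
(1) and `headSum L l / (n - l + 1)` in case (2). Conversely, an optimal `ν` defines a box with one
budget constraint that attains the bound (`exists_isPriceOfMMF_eq`). -/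

lemma sort_apply_le_iff {n : ℕ} (f : Fin n → ℝ) (k : Fin n) (a : ℝ) :
    (f ∘ Tuple.sort f) k ≤ a ↔ (k : ℕ) < Fintype.card {i // f i ≤ a} := by
  rw [← Tuple.lt_card_le_iff_apply_le_of_monotone (j := k) (Tuple.monotone_sort f),
    ← Fintype.card_subtype]
  rw [Fintype.card_congr ((Tuple.sort f).subtypeEquiv (p := fun i => (f ∘ Tuple.sort f) i ≤ a)
    (q := fun i => f i ≤ a) (fun i => Iff.rfl))]

lemma sort_apply_le_add {n : ℕ} (f g : Fin n → ℝ) (d : ℝ) (h : ∀ i, f i ≤ g i + d) (k : Fin n) :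
    (f ∘ Tuple.sort f) k ≤ (g ∘ Tuple.sort g) k + d := by
  rw [sort_apply_le_iff]
  refine lt_of_lt_of_le ((sort_apply_le_iff g k _).1 le_rfl) ?_
  exact Fintype.card_subtype_mono _ _ (fun i hi => (h i).trans (by linarith [show g i ≤ _ from hi]))

/-- The sorting permutation jumps, but each order statistic is 1-Lipschitz for the sup distance, by
counting the entries below a level. -/
lemma continuous_sort_apply {n : ℕ} (k : Fin n) :
    Continuous (fun f : Fin n → ℝ => (f ∘ Tuple.sort f) k) := by
  refine (LipschitzWith.of_dist_le_mul (K := 1) fun f g => ?_).continuous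
  have h : ∀ i, |f i - g i| ≤ dist f g := fun i => dist_le_pi_dist f g i
  have h1 := sort_apply_le_add f g (dist f g) (fun i => by linarith [(abs_le.1 (h i)).2]) k
  have h2 := sort_apply_le_add g f (dist f g) (fun i => by linarith [(abs_le.1 (h i)).1]) k
  rw [NNReal.coe_one, one_mul, Real.dist_eq, abs_le]
  constructor <;> linarith

lemma continuous_sortedRatios {n : ℕ} (L : Fin n → ℝ) : Continuous (sortedRatios L) := by
  have h : Continuous fun (u : Fin n → ℝ) i => u i / L i :=
    continuous_pi fun i => Continuous.div_const (continuous_apply (A := fun _ => ℝ) i) (L i)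
  have hk : ∀ k, Continuous fun u => sortedRatios L u k := fun k =>
    (continuous_sort_apply k).comp h
  exact continuous_pi hk

lemma IsCompact.exists_isMaxOn_toLex {X : Type*} [TopologicalSpace X] {n : ℕ} {K : Set X}
    (hK : IsCompact K) (hne : K.Nonempty) {g : X → Fin n → ℝ} (hg : Continuous g) :
    ∃ u ∈ K, ∀ v ∈ K, toLex (g v) ≤ toLex (g u) := by
  -- Maximize one coordinate at a time: `K'` consists of the points of `K` that are
  -- lexicographically optimal in the first `m` coordinates.
  have key : ∀ m ≤ n, ∃ K' ⊆ K, IsCompact K' ∧ K'.Nonempty ∧ ∀ u ∈ K', ∀ v ∈ K,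
      toLex (g v) < toLex (g u) ∨ ((∀ i : Fin n, (i : ℕ) < m → g v i = g u i) ∧ v ∈ K') := by
    intro m
    induction m with
    | zero => exact fun _ => ⟨K, subset_rfl, hK, hne, fun u _ v hv => Or.inr ⟨by simp, hv⟩⟩
    | succ m ih =>
      intro hm
      obtain ⟨K', hsub, hK', hne', h⟩ := ih (by omega)
      have hc : Continuous fun x => g x ⟨m, hm⟩ := (continuous_apply _).comp hg
      obtain ⟨z, hz, hmax⟩ := hK'.exists_isMaxOn hne' hc.continuousOn
      have hmax : ∀ v ∈ K', g v ⟨m, hm⟩ ≤ g z ⟨m, hm⟩ := hmax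
      refine ⟨K' ∩ {x | g z ⟨m, hm⟩ ≤ g x ⟨m, hm⟩}, fun x hx => hsub hx.1,
        hK'.inter_right (isClosed_le continuous_const hc), ⟨z, hz, le_refl (g z _)⟩, ?_⟩
      rintro u ⟨hu, hzu⟩ v hv
      rcases h u hu v hv with hlt | ⟨heq, hv'⟩
      · exact Or.inl hlt
      · rcases (le_trans (hmax v hv') hzu).lt_or_eq with hlt | he
        · exact Or.inl ⟨⟨m, hm⟩, fun j hj => heq j hj, hlt⟩
        · refine Or.inr ⟨fun i hi => ?_, hv', ?_⟩
          · rcases Nat.lt_succ_iff_lt_or_eq.1 hi with hi | hi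
            · exact heq i hi
            · rw [show i = ⟨m, hm⟩ from Fin.ext hi]; exact he
          · exact hzu.trans he.ge
  obtain ⟨K', hsub, -, ⟨u, hu⟩, h⟩ := key n le_rfl
  refine ⟨u, hsub hu, fun v hv => ?_⟩
  rcases h u hu v hv with hlt | ⟨heq, -⟩
  · exact hlt.le
  · rw [show g v = g u from funext fun i => heq i i.2]

lemma IsUtilitySet.nonempty {n : ℕ} {L : Fin n → ℝ} {U : Set (Fin n → ℝ)}
    (hU : IsUtilitySet L U) (i : Fin n) : U.Nonempty :=
  ⟨_, (hU.isGreatest i).1.choose_spec.1⟩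

lemma IsUtilitySet.exists_isPriceOfMMF {n : ℕ} {L : Fin n → ℝ} {U : Set (Fin n → ℝ)}
    (hU : IsUtilitySet L U) (i : Fin n) : ∃ p, IsPriceOfMMF L U p := by
  obtain ⟨u, hu, hmmf⟩ :=
    hU.compact.exists_isMaxOn_toLex (hU.nonempty i) (continuous_sortedRatios L)
  obtain ⟨w, hw, hmax⟩ := hU.compact.exists_isMaxOn (hU.nonempty i)
    (f := fun v : Fin n → ℝ => ∑ i, v i) (by fun_prop)
  exact ⟨_, u, w, ⟨hu, hmmf⟩, ⟨hw, fun v hv => hmax hv⟩, rfl⟩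

/-! ### Smallest ratio of a max-min fair solution -/

lemma toLex_lt_of_zero_lt {n : ℕ} [NeZero n] {f g : Fin n → ℝ} (h : f 0 < g 0) :
    toLex f < toLex g :=
  ⟨0, fun j hj => absurd hj (Fin.not_lt_zero j), h⟩

lemma sortedRatios_zero_le {n : ℕ} [NeZero n] (L u : Fin n → ℝ) (i : Fin n) :
    sortedRatios L u 0 ≤ u i / L i := by
  have h := Tuple.monotone_sort (fun i => u i / L i)
    (Fin.zero_le ((Tuple.sort (fun i => u i / L i)).symm i))
  simp only [Function.comp_apply, Equiv.apply_symm_apply] at h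
  exact h

lemma exists_ratio_eq_sortedRatios {n : ℕ} (L u : Fin n → ℝ) (k : Fin n) :
    ∃ i, u i / L i = sortedRatios L u k := ⟨_, rfl⟩

lemma sortedRatios_of_forall_eq {n : ℕ} {L u : Fin n → ℝ} {t : ℝ} (h : ∀ i, u i / L i = t) :
    sortedRatios L u = fun _ => t := funext fun _ => h _

/-- A convex set containing no vector with all coordinates above `t` lies below a hyperplane with
non-negative normal vector through the constant vector `t`. -/
lemma exists_weights_of_forall_exists_le {n : ℕ} {X : Set (Fin n → ℝ)} (hX : Convex ℝ X)
    (hne : X.Nonempty) {t : ℝ} (h : ∀ x ∈ X, ∃ i, x i ≤ t) :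
    ∃ w : Fin n → ℝ, (∀ i, 0 ≤ w i) ∧ 0 < ∑ i, w i ∧ ∀ x ∈ X, ∑ i, w i * x i ≤ t * ∑ i, w i := by
  have hopen : IsOpen {y : Fin n → ℝ | ∀ i, t < y i} := by
    simp only [Set.ofPred_forall]
    exact isOpen_iInter_of_finite fun i => isOpen_lt continuous_const (continuous_apply i)
  have hconv : Convex ℝ {y : Fin n → ℝ | ∀ i, t < y i} := by
    simp only [Set.ofPred_forall]
    exact convex_iInter fun i => (convex_Ioi t).is_linear_preimage
      (LinearMap.proj (R := ℝ) (φ := fun _ : Fin n => ℝ) i).isLinear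
  obtain ⟨f, c, hf1, hf2⟩ := geometric_hahn_banach_open hconv hopen hX
    (Set.disjoint_left.2 fun y hy hyX => by
      obtain ⟨i, hi⟩ := h y hyX
      exact absurd (hy i) (not_lt.2 hi))
  have hf : ∀ x : Fin n → ℝ, f x = ∑ i, f (Pi.single i 1) * x i := fun x => by
    conv_lhs => rw [pi_eq_sum_univ' x]
    rw [map_sum]
    refine Finset.sum_congr rfl fun i _ => ?_
    rw [map_smul, smul_eq_mul, mul_comm]
  have hneg : ∀ i, f (Pi.single i 1) ≤ 0 := fun i => by
    by_contra! hpos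
    have hy := fun r : ℝ => fun hr : 0 ≤ r => hf1 ((fun _ => t + 1) + r • Pi.single i 1) (fun j => by
      have : 0 ≤ r * (Pi.single i 1 : Fin n → ℝ) j := by
        refine mul_nonneg hr ?_
        rw [Pi.single_apply]; split_ifs <;> norm_num
      simp only [Pi.add_apply, Pi.smul_apply, smul_eq_mul]; linarith)
    have h0 := hy 0 le_rfl
    simp only [zero_smul, add_zero] at h0
    -- This step length makes `f` equal to `c` at a point of the open orthant, where `f < c`.
    have := hy ((c - f fun _ => t + 1) / f (Pi.single i 1)) (div_nonneg (by linarith) hpos.le)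
    rw [map_add, map_smul, smul_eq_mul, div_mul_cancel₀ _ hpos.ne'] at this
    linarith
  have hconst : ∀ a : ℝ, f (fun _ => a) = a * ∑ i, f (Pi.single i 1) := fun a => by
    rw [hf, Finset.mul_sum]; exact Finset.sum_congr rfl fun i _ => mul_comm _ _
  obtain ⟨x0, hx0⟩ := hne
  refine ⟨fun i => -f (Pi.single i 1), fun i => by linarith [hneg i], ?_, fun x hx => ?_⟩
  · rw [Finset.sum_neg_distrib, neg_pos]
    refine lt_of_le_of_ne (Finset.sum_nonpos fun i _ => hneg i) fun h0 => ?_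
    have hz : ∀ i, f (Pi.single i 1) = 0 := fun i =>
      (Finset.sum_eq_zero_iff_of_nonpos fun i _ => hneg i).1 h0 i (Finset.mem_univ i)
    have h1 := hf1 (fun _ => t + 1) (fun _ => by linarith)
    have h2 := hf2 x0 hx0
    rw [hf] at h1 h2
    simp only [hz, zero_mul, Finset.sum_const_zero] at h1 h2
    linarith
  · have h2 := hf2 x hx
    rw [hf] at h2
    simp only [neg_mul, Finset.sum_neg_distrib, mul_neg]
    rw [neg_le_neg_iff]
    refine le_trans ?_ h2
    -- The constant vector `t` is only on the boundary of the orthant, so it is approached from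
    -- inside. Since `S ≤ 0`, the shift `ε / (1 - S)` changes `f` by at most `ε`.
    refine le_of_forall_pos_le_add fun ε hε => ?_
    set S := ∑ i, f (Pi.single i 1) with hS
    have hS0 : S ≤ 0 := Finset.sum_nonpos fun i _ => hneg i
    have h1 := hf1 (fun _ => t + ε / (1 - S)) (fun _ => by
      have : 0 < ε / (1 - S) := div_pos hε (by linarith)
      linarith)
    rw [hconst] at h1
    have h3 : ε / (1 - S) * (1 - S) = ε := div_mul_cancel₀ _ (by linarith)
    have h4 : 0 < ε / (1 - S) := div_pos hε (by linarith)
    nlinarith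

/-! ### The bilinear optimization problem -/

/-- `G` bounds `(∑ ν) (∑ L x)` over all `ν, x ∈ [0, 1]ⁿ` with `∑ ν x ≤ 1`. -/
def IsBilinearBound {n : ℕ} (L : Fin n → ℝ) (G : ℝ) : Prop :=
  ∀ ν x : Fin n → ℝ, (∀ i, 0 ≤ ν i) → (∀ i, ν i ≤ 1) → (∀ i, 0 ≤ x i) → (∀ i, x i ≤ 1) →
    ∑ i, ν i * x i ≤ 1 → (∑ i, ν i) * ∑ i, L i * x i ≤ G

lemma card_filter_lt {n : ℕ} (l : Fin n) : (Finset.univ.filter (fun i => i < l)).card = l := by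
  rw [Finset.filter_gt_eq_Iio, Fin.card_Iio]

lemma sum_ite_lt_eq {n : ℕ} (f : Fin n → ℝ) (l : Fin n) (c : ℝ) :
    ∑ i, (if i < l then f i - c else 0) = headSum f l - (l : ℕ) * c := by
  rw [← Finset.sum_filter, Finset.sum_sub_distrib, Finset.sum_const, headSum, nsmul_eq_mul]
  rw [card_filter_lt]

/-- With `A = ∑ ν` and `B = ∑ L x`, eliminating `∑ x` from two linear estimates bounds `c A + B`;
then `4 c A B ≤ (c A + B)²`. -/
lemma isBilinearBound_of_slope {n : ℕ} {L : Fin n → ℝ} (hpos : ∀ i, 0 < L i) (l : Fin n) {c : ℝ}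
    (hc : 0 < c) (h1 : ∀ i < l, c ≤ L i) (h2 : ∀ i, l ≤ i → L i ≤ c) :
    IsBilinearBound L ((headSum L l + ((n : ℝ) - (l : ℕ) + 1) * c) ^ 2 / (4 * c)) := by
  intro ν x hν0 hν1 hx0 hx1 hνx
  -- Termwise, `L i * x i ≤ c * x i + max (L i - c) 0`; the positive parts live on `i < l`.
  have hB : ∑ i, L i * x i ≤ headSum L l - (l : ℕ) * c + c * ∑ i, x i := by
    rw [← sum_ite_lt_eq, Finset.mul_sum, ← Finset.sum_add_distrib]
    refine Finset.sum_le_sum fun i _ => ?_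
    split_ifs with hi
    · nlinarith [h1 i hi, hx1 i]
    · nlinarith [h2 i (not_lt.1 hi), hx0 i]
  -- Sum of `(1 - ν i) (1 - x i) ≥ 0`.
  have hA : ∑ i, ν i + ∑ i, x i - n ≤ 1 := by
    refine le_trans ?_ hνx
    have : (n : ℝ) = ∑ _i : Fin n, (1 : ℝ) := by simp
    rw [this, ← Finset.sum_add_distrib, ← Finset.sum_sub_distrib]
    exact Finset.sum_le_sum fun i _ => by nlinarith [hν1 i, hx1 i]
  have hA0 : 0 ≤ ∑ i, ν i := Finset.sum_nonneg fun i _ => hν0 i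
  have hB0 : 0 ≤ ∑ i, L i * x i := Finset.sum_nonneg fun i _ => mul_nonneg (hpos i).le (hx0 i)
  rw [le_div_iff₀ (by positivity)]
  set A := ∑ i, ν i
  set B := ∑ i, L i * x i
  have h : c * A + B ≤ headSum L l + ((n : ℝ) - (l : ℕ) + 1) * c := by nlinarith
  have h0 : 0 ≤ c * A + B := by positivity
  nlinarith [sq_nonneg (c * A - B), pow_le_pow_left₀ h0 h 2]

lemma isBilinearBound_le {n : ℕ} [NeZero n] {L : Fin n → ℝ} (hpos : ∀ i, 0 < L i) {G : ℝ}
    (hG : IsBilinearBound L G) {U : Set (Fin n → ℝ)} (hU : IsUtilitySet L U) {p : ℝ}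
    (hp : IsPriceOfMMF L U p) : p ≤ 1 - (∑ i, L i) / G := by
  obtain ⟨u, w, ⟨huU, hu⟩, ⟨hwU, hw⟩, rfl⟩ := hp
  set t := sortedRatios L u 0 with ht
  have hconv : Convex ℝ ((fun v : Fin n → ℝ => fun i => v i / L i) '' U) := by
    let T : (Fin n → ℝ) →ₗ[ℝ] (Fin n → ℝ) :=
      { toFun := fun v i => v i / L i
        map_add' := fun a b => by ext i; simp [add_div]
        map_smul' := fun a b => by ext i; simp [mul_div_assoc] }
    exact hU.convex.linear_image T
  obtain ⟨m, hm0, hmpos, hm⟩ := exists_weights_of_forall_exists_le (t := t) hconv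
    ((hU.nonempty 0).image _) (by
      rintro _ ⟨v, hv, rfl⟩
      by_contra! hlt
      obtain ⟨i, hi⟩ := exists_ratio_eq_sortedRatios L v 0
      exact absurd (hu v hv) (not_le.2 (toLex_lt_of_zero_lt (hi ▸ hlt i))))
  have hm' : ∀ v ∈ U, ∑ i, m i * (v i / L i) ≤ t * ∑ i, m i := fun v hv => hm _ ⟨v, hv, rfl⟩
  -- Test the hyperplane at a point where player `i` has ratio 1. This also forces `t > 0`.
  have hmt : ∀ i, m i ≤ t * ∑ i, m i := fun i => by
    obtain ⟨v, hv, hvi⟩ := (hU.isGreatest i).1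
    refine le_trans ?_ (hm' v hv)
    have h := Finset.single_le_sum (f := fun j => m j * (v j / L j))
      (fun j _ => mul_nonneg (hm0 j) (div_nonneg (hU.nonneg v hv j) (hpos j).le))
      (Finset.mem_univ i)
    have hvi : v i = L i := hvi
    simpa [hvi, (hpos i).ne'] using h
  have htm : 0 < t * ∑ i, m i := by
    obtain ⟨i, -, hi⟩ := Finset.exists_lt_of_sum_lt (s := Finset.univ) (f := fun _ : Fin n => (0 : ℝ))
      (g := m) (by simpa using hmpos)
    exact hi.trans_le (hmt i)
  have htpos : 0 < t := pos_of_mul_pos_left htm hmpos.le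
  have hb := hG (fun i => m i / (t * ∑ i, m i)) (fun i => w i / L i)
    (fun i => div_nonneg (hm0 i) htm.le) (fun i => (div_le_one htm).2 (hmt i))
    (fun i => div_nonneg (hU.nonneg w hwU i) (hpos i).le)
    (fun i => (div_le_one (hpos i)).2 ((hU.isGreatest i).2 ⟨w, hwU, rfl⟩)) (by
      rw [Finset.sum_congr rfl fun i _ => div_mul_eq_mul_div (m i) (t * ∑ i, m i) (w i / L i),
        ← Finset.sum_div]
      exact (div_le_one htm).2 (hm' w hwU))
  rw [← Finset.sum_div, div_mul_cancel_right₀ hmpos.ne',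
    Finset.sum_congr rfl fun i _ => mul_div_cancel₀ (w i) (hpos i).ne'] at hb
  have hL : 0 < ∑ i, L i := Finset.sum_pos (fun i _ => hpos i) Finset.univ_nonempty
  have hsum : t * ∑ i, L i ≤ ∑ i, u i := by
    rw [Finset.mul_sum]
    exact Finset.sum_le_sum fun i _ => (le_div_iff₀ (hpos i)).1 (sortedRatios_zero_le L u i)
  have hwpos : 0 < ∑ i, w i := (mul_pos htpos hL).trans_le (hsum.trans (hw u huU))
  have hGpos : 0 < G := (mul_pos (inv_pos.2 htpos) hwpos).trans_le hb
  have hwG : ∑ i, w i ≤ t * G := by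
    rwa [inv_mul_le_iff₀ htpos] at hb
  have : (∑ i, L i) / G ≤ (∑ i, u i) / ∑ i, w i := by
    rw [div_le_div_iff₀ hGpos hwpos]
    nlinarith
  linarith

/-! ### Utility sets attaining the bound -/

/-- The condition `ν i ≤ 1` lets player `i` alone take `L i` within the budget. -/
lemma isUtilitySet_budget {n : ℕ} {L ν : Fin n → ℝ} (hpos : ∀ i, 0 < L i) (h1 : ∀ i, ν i ≤ 1) :
    IsUtilitySet L {u | (∀ i, 0 ≤ u i) ∧ (∀ i, u i ≤ L i) ∧ ∑ i, ν i * (u i / L i) ≤ 1} where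
  nonneg u hu := hu.1
  convex := by
    rintro u ⟨hu1, hu2, hu3⟩ v ⟨hv1, hv2, hv3⟩ a b ha hb hab
    refine ⟨fun i => ?_, fun i => ?_, ?_⟩
    · have := hu1 i; have := hv1 i
      simp only [Pi.add_apply, Pi.smul_apply, smul_eq_mul]; positivity
    · simp only [Pi.add_apply, Pi.smul_apply, smul_eq_mul]
      calc a * u i + b * v i ≤ a * L i + b * L i := by
            gcongr
            exacts [hu2 i, hv2 i]
        _ = L i := by rw [← add_mul, hab, one_mul]
    · have : ∑ i, ν i * ((a • u + b • v) i / L i)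
          = a * ∑ i, ν i * (u i / L i) + b * ∑ i, ν i * (v i / L i) := by
        rw [Finset.mul_sum, Finset.mul_sum, ← Finset.sum_add_distrib]
        refine Finset.sum_congr rfl fun i _ => ?_
        simp only [Pi.add_apply, Pi.smul_apply, smul_eq_mul]; ring
      rw [this]
      nlinarith
  compact := by
    have hcl : IsClosed {u : Fin n → ℝ | ∑ i, ν i * (u i / L i) ≤ 1} :=
      isClosed_le (by fun_prop) continuous_const
    convert (isCompact_Icc (a := (0 : Fin n → ℝ)) (b := L)).inter_right hcl using 1
    ext u
    simp [Pi.le_def, and_assoc]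
  isGreatest i := by
    refine ⟨⟨Pi.single i (L i), ⟨fun j => ?_, fun j => ?_, ?_⟩, by simp⟩, ?_⟩
    · rw [Pi.single_apply]; split_ifs with h
      · exact (hpos i).le
      · exact le_rfl
    · rw [Pi.single_apply]; split_ifs with h
      · rw [h]
      · exact (hpos j).le
    · rw [Finset.sum_eq_single i (fun j _ hj => by simp [hj]) (by simp)]
      simpa [(hpos i).ne'] using h1 i
    · rintro _ ⟨u, hu, rfl⟩
      exact hu.2.1 i

lemma isMonotoneSet_budget {n : ℕ} {L ν : Fin n → ℝ} (hpos : ∀ i, 0 < L i) (h0 : ∀ i, 0 ≤ ν i) :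
    IsMonotoneSet {u | (∀ i, 0 ≤ u i) ∧ (∀ i, u i ≤ L i) ∧ ∑ i, ν i * (u i / L i) ≤ 1} := by
  rintro u ⟨-, hu2, hu3⟩ v hv hvu
  refine ⟨hv, fun i => (hvu i).trans (hu2 i), le_trans (Finset.sum_le_sum fun i _ => ?_) hu3⟩
  have := hvu i; have := hpos i; have := h0 i
  gcongr

/-- Equal ratios `1 / ∑ ν` exhaust the budget; as all prices are positive, no feasible point can
have every ratio at least this large unless all are equal to it. -/
lemma isMaxMinFair_budget {n : ℕ} [NeZero n] {L ν : Fin n → ℝ} (hpos : ∀ i, 0 < L i)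
    (h0 : ∀ i, 0 < ν i) (hs : 1 ≤ ∑ i, ν i) :
    IsMaxMinFair L {u | (∀ i, 0 ≤ u i) ∧ (∀ i, u i ≤ L i) ∧ ∑ i, ν i * (u i / L i) ≤ 1}
      (fun i => (∑ i, ν i)⁻¹ * L i) := by
  have hs0 : 0 < ∑ i, ν i := by linarith
  have hr : ∀ i, (∑ i, ν i)⁻¹ * L i / L i = (∑ i, ν i)⁻¹ := fun i =>
    mul_div_cancel_right₀ _ (hpos i).ne'
  refine ⟨⟨fun i => mul_nonneg (inv_nonneg.2 hs0.le) (hpos i).le,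
    fun i => mul_le_of_le_one_left (hpos i).le (inv_le_one_of_one_le₀ hs), ?_⟩, ?_⟩
  · simp only [hr]
    rw [← Finset.sum_mul, mul_inv_cancel₀ hs0.ne']
  · rintro v ⟨-, -, hv⟩
    rw [sortedRatios_of_forall_eq hr]
    rcases lt_or_ge (sortedRatios L v 0) (∑ i, ν i)⁻¹ with hlt | hge
    · exact (toLex_lt_of_zero_lt hlt).le
    · have hle : ∀ i, (∑ i, ν i)⁻¹ ≤ v i / L i := fun i => hge.trans (sortedRatios_zero_le L v i)
      have heq : ∀ i, ν i * (∑ i, ν i)⁻¹ = ν i * (v i / L i) := fun i => by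
        refine (Finset.sum_eq_sum_iff_of_le
          (fun i _ => mul_le_mul_of_nonneg_left (hle i) (h0 i).le)).1 ?_ i (Finset.mem_univ i)
        refine le_antisymm
          (Finset.sum_le_sum fun i _ => mul_le_mul_of_nonneg_left (hle i) (h0 i).le) ?_
        rwa [← Finset.sum_mul, mul_inv_cancel₀ hs0.ne']
      rw [sortedRatios_of_forall_eq fun i => (mul_left_cancel₀ (h0 i).ne' (heq i)).symm]

lemma sum_ite_lt_const {n : ℕ} (l : Fin n) (a : ℝ) :
    ∑ i, (if i < l then a else 1) = (l : ℕ) * a + (n - (l : ℕ)) := by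
  have h := sum_ite_lt_eq (fun _ : Fin n => a) l 1
  have h2 : ∑ i, (if i < l then a else 1) = ∑ i, ((if i < l then a - 1 else 0) + 1) :=
    Finset.sum_congr rfl fun i _ => by split_ifs <;> ring
  rw [h2, Finset.sum_add_distrib, h, headSum]
  simp [card_filter_lt]
  ring

/-- The pair `ν`, `x` is built for equality in the linear estimates: `ν < 1` only where `x = 1`, and
`x` fills the largest `L i` first, with fraction `ξ` at `l`. The first `l` prices total `1 - ξ`, so
`x` costs exactly 1. -/
lemma exists_isPriceOfMMF_eq {n : ℕ} [NeZero n] {L : Fin n → ℝ} (hpos : ∀ i, 0 < L i)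
    (l : Fin n) (hl : 1 ≤ (l : ℕ)) {ξ : ℝ} (hξ0 : 0 ≤ ξ) (hξ1 : ξ < 1)
    (hG : IsBilinearBound L (((n : ℝ) - (l : ℕ) + 1 - ξ) * (headSum L l + ξ * L l))) :
    ∃ U : Set (Fin n → ℝ), IsUtilitySet L U ∧ IsMonotoneSet U ∧ IsPriceOfMMF L U
      (1 - (∑ i, L i) / (((n : ℝ) - (l : ℕ) + 1 - ξ) * (headSum L l + ξ * L l))) := by
  have hl' : (1 : ℝ) ≤ (l : ℕ) := by exact_mod_cast hl
  have hln : ((l : ℕ) : ℝ) + 1 ≤ n := by exact_mod_cast l.2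
  set a := (1 - ξ) / (l : ℕ) with ha
  have hal : (l : ℕ) * a = 1 - ξ := mul_div_cancel₀ _ (by linarith)
  have ha0 : 0 < a := div_pos (by linarith) (by linarith)
  have ha1 : a ≤ 1 := (div_le_one (by linarith)).2 (by linarith)
  let ν : Fin n → ℝ := fun i => if i < l then a else 1
  let x : Fin n → ℝ := fun i => (if i < l then 1 else 0) + if i = l then ξ else 0
  have hν0 : ∀ i, 0 < ν i := fun i => by simp only [ν]; split_ifs <;> linarith
  have hν1 : ∀ i, ν i ≤ 1 := fun i => by simp only [ν]; split_ifs <;> linarith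
  have hνs : ∑ i, ν i = (n : ℝ) - (l : ℕ) + 1 - ξ := by
    simp only [ν]; rw [sum_ite_lt_const, hal]; ring
  have hx : ∀ f : Fin n → ℝ, ∑ i, f i * x i = headSum f l + ξ * f l := fun f => by
    simp only [x, mul_add, Finset.sum_add_distrib, mul_ite, mul_one, mul_zero,
      Finset.sum_ite_eq', Finset.mem_univ, if_true, headSum, Finset.sum_filter]
    rw [mul_comm]
  have hx0 : ∀ i, 0 ≤ x i := fun i => by simp only [x]; split_ifs <;> linarith
  have hx1 : ∀ i, x i ≤ 1 := fun i => by
    rcases lt_trichotomy i l with h | h | h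
    · simp [x, h, h.ne]
    · simp [x, h, hξ1.le]
    · simp [x, h.not_gt, h.ne']
  have hνh : headSum ν l = (l : ℕ) * a := by
    rw [headSum, Finset.sum_congr rfl (g := fun _ => a) fun i hi =>
      if_pos (Finset.mem_filter.1 hi).2]
    simp [card_filter_lt]
  have hνx : ∑ i, ν i * x i = 1 := by
    rw [hx, hνh, hal]; simp [ν]
  have hs1 : 1 ≤ ∑ i, ν i := by rw [hνs]; linarith
  have hLx : ∀ i, L i * x i / L i = x i := fun i => mul_div_cancel_left₀ _ (hpos i).ne'
  refine ⟨_, isUtilitySet_budget hpos hν1, isMonotoneSet_budget hpos fun i => (hν0 i).le,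
    _, fun i => L i * x i, isMaxMinFair_budget hpos hν0 hs1,
    ⟨⟨fun i => mul_nonneg (hpos i).le (hx0 i), fun i => mul_le_of_le_one_right (hpos i).le (hx1 i),
      by simp only [hLx]; exact hνx.le⟩, ?_⟩, ?_⟩
  · rintro v ⟨hv1, hv2, hv3⟩
    -- For this fixed `ν` the bilinear bound, divided by `∑ ν`, says that `L x` is utilitarian.
    have h := hG ν (fun i => v i / L i) (fun i => (hν0 i).le) hν1
      (fun i => div_nonneg (hv1 i) (hpos i).le) (fun i => (div_le_one (hpos i)).2 (hv2 i)) hv3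
    rw [← hνs, ← hx, Finset.sum_congr rfl fun i _ => mul_div_cancel₀ (v i) (hpos i).ne'] at h
    exact le_of_mul_le_mul_left h (by linarith)
  · rw [hx, ← Finset.mul_sum, hνs, div_mul_eq_div_div, inv_mul_eq_div]

/-! ### Choice of the slope in each case -/

theorem theorem3 (n : ℕ) (hn : 2 ≤ n) (L : Fin n → ℝ) (hpos : ∀ i, 0 < L i)
    (hanti : Antitone L) :
    -- the price of max-min fairness is defined for every utility set
    (∀ U : Set (Fin n → ℝ), IsUtilitySet L U → ∃ p, IsPriceOfMMF L U p) ∧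
    -- case (1), with tightness
    ((indexSet₁ L).Nonempty → ∃ l, IsGreatest (indexSet₁ L) l ∧
      (∀ U : Set (Fin n → ℝ), IsUtilitySet L U →
        ∀ p, IsPriceOfMMF L U p → p ≤ mmfBound₁ L l) ∧
      (∃ U : Set (Fin n → ℝ), IsUtilitySet L U ∧ IsMonotoneSet U ∧
        IsPriceOfMMF L U (mmfBound₁ L l))) ∧
    -- case (2), with tightness
    (indexSet₁ L = ∅ → ∃ l, IsLeast (indexSet₂ L) l ∧
      (∀ U : Set (Fin n → ℝ), IsUtilitySet L U →
        ∀ p, IsPriceOfMMF L U p → p ≤ mmfBound₂ L l) ∧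
      (∃ U : Set (Fin n → ℝ), IsUtilitySet L U ∧ IsMonotoneSet U ∧
        IsPriceOfMMF L U (mmfBound₂ L l))) ∧
    -- equal maximum utilities
    ((∀ i j, L i = L j) → ∃ l, IsGreatest (indexSet₁ L) l ∧
      mmfBound₁ L l = 1 - 4 * (n : ℝ) / ((n : ℝ) + 1) ^ 2) := by
  have : NeZero n := ⟨by omega⟩
  have hgreatest : (indexSet₁ L).Nonempty → ∃ l, IsGreatest (indexSet₁ L) l := fun h => by
    obtain ⟨l, hl, hmax⟩ := Set.exists_max_image _ id (Set.toFinite (indexSet₁ L)) h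
    exact ⟨l, hl, fun j hj => hmax j hj⟩
  refine ⟨fun U hU => hU.exists_isPriceOfMMF 0, fun h => ?_, fun h => ?_, fun heq => ?_⟩
  · obtain ⟨l, hl⟩ := hgreatest h
    obtain ⟨hl1, hlo, hhi⟩ := hl.1
    have hG := isBilinearBound_of_slope hpos l (hpos l) (fun i hi => hanti hi.le)
      (fun i hi => hanti hi)
    have hLl := hpos l
    have hb : mmfBound₁ L l = 1 - (∑ i, L i) /
        ((headSum L l + ((n : ℝ) - (l : ℕ) + 1) * L l) ^ 2 / (4 * L l)) := by
      rw [mmfBound₁, div_div_eq_mul_div, mul_comm (∑ i, L i)]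
    refine ⟨l, hl, fun U hU p hp => hb ▸ isBilinearBound_le hpos hG hU hp, ?_⟩
    -- AM-GM is an equality when `L l * (n - l + 1 - ξ) = headSum L l + ξ * L l`, which determines
    -- `ξ`; the two inequalities of `indexSet₁` are then exactly `ξ < 1` and `0 ≤ ξ`.
    have hval : (headSum L l + ((n : ℝ) - (l : ℕ) + 1) * L l) ^ 2 / (4 * L l) =
        ((n : ℝ) - (l : ℕ) + 1 - ((n : ℝ) - (l : ℕ) + 1 - headSum L l / L l) / 2) *
          (headSum L l + ((n : ℝ) - (l : ℕ) + 1 - headSum L l / L l) / 2 * L l) := by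
      field_simp
      ring
    rw [hb, hval]
    rw [hval] at hG
    refine exists_isPriceOfMMF_eq hpos l hl1 ?_ ?_ hG
    · have := (div_le_iff₀ hLl).2 hhi
      linarith
    · have := (lt_div_iff₀ hLl).2 hlo
      linarith
  -- At the last index the lower inequality of `indexSet₁` is `0 < headSum`, which always holds, so
  -- only the upper one can fail.
  · have hne : (indexSet₂ L).Nonempty := by
      refine ⟨⟨n - 1, by omega⟩, by simp; omega, ?_⟩
      by_contra hle
      refine Set.eq_empty_iff_forall_notMem.1 h ⟨n - 1, by omega⟩ ⟨by simp; omega, ?_, not_lt.1 hle⟩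
      have h1 : ((n - 1 : ℕ) : ℝ) = n - 1 := by rw [Nat.cast_sub (by omega), Nat.cast_one]
      simp only [h1]
      rw [show (n : ℝ) - (n - 1) - 1 = 0 by ring, zero_mul]
      refine Finset.sum_pos (fun i _ => hpos i) ⟨⟨0, by omega⟩, ?_⟩
      rw [Finset.mem_filter, Fin.lt_def]
      exact ⟨Finset.mem_univ _, by simp only; omega⟩
    obtain ⟨l, hl, hmin⟩ := Set.exists_min_image _ id (Set.toFinite (indexSet₂ L)) hne
    have hmin : ∀ j ∈ indexSet₂ L, l ≤ j := hmin
    obtain ⟨hl1, hlt⟩ := hl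
    have hln : ((l : ℕ) : ℝ) + 1 ≤ n := by exact_mod_cast l.2
    have hk : 0 < (n : ℝ) - (l : ℕ) + 1 := by linarith
    have hH : 0 < headSum L l := lt_trans (mul_pos hk (hpos l)) hlt
    obtain ⟨k, hkl⟩ : ∃ k : Fin n, (k : ℕ) + 1 = l := ⟨⟨l - 1, by omega⟩, by simp; omega⟩
    have hsucc : headSum L l = headSum L k + L k := by
      have : Finset.univ.filter (fun i : Fin n => i < l) =
          insert k (Finset.univ.filter (fun i : Fin n => i < k)) := by
        ext i
        simp only [Finset.mem_filter, Finset.mem_univ, true_and, Finset.mem_insert, Fin.lt_def,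
          Fin.ext_iff]
        omega
      rw [headSum, this, Finset.sum_insert (by simp), headSum, add_comm]
    have hkl' : ((l : ℕ) : ℝ) = (k : ℕ) + 1 := by exact_mod_cast hkl.symm
    -- If `k ≥ 1`, it lies in neither index set, so `headSum L k ≤ (n - k - 1) * L k`; adding `L k`
    -- gives `headSum L l ≤ (n - l + 1) * L k`. Thus the slope lies between `L l` and `L k`, and
    -- equality is reached with `ξ = 0`.
    have hck : headSum L l / ((n : ℝ) - (l : ℕ) + 1) ≤ L k := by
      rw [div_le_iff₀ hk, hsucc]
      by_cases hk1 : 1 ≤ (k : ℕ)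
      · have hn2 : ¬ headSum L k > ((n : ℝ) - (k : ℕ) + 1) * L k := fun hgt =>
          absurd (hmin k ⟨hk1, hgt⟩) (by rw [Fin.le_def]; omega)
        have hn1 : ¬ ((n : ℝ) - (k : ℕ) - 1) * L k < headSum L k := fun hgt =>
          Set.eq_empty_iff_forall_notMem.1 h k ⟨hk1, hgt, not_lt.1 hn2⟩
        rw [hkl']
        nlinarith
      · have : headSum L k = 0 := by
          rw [headSum, Finset.filter_false_of_mem, Finset.sum_empty]
          intro i _
          rw [Fin.lt_def]; omega
        rw [this]
        nlinarith [hpos k]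
    have hG := isBilinearBound_of_slope hpos l (div_pos hH hk)
      (fun i hi => hck.trans (hanti (by rw [Fin.lt_def] at hi; rw [Fin.le_def]; omega)))
      (fun i hi => (hanti hi).trans (((lt_div_iff₀ hk).2 (by linarith)).le))
    have hval : (headSum L l + ((n : ℝ) - (l : ℕ) + 1) *
        (headSum L l / ((n : ℝ) - (l : ℕ) + 1))) ^ 2 /
        (4 * (headSum L l / ((n : ℝ) - (l : ℕ) + 1))) =
        ((n : ℝ) - (l : ℕ) + 1 - 0) * (headSum L l + 0 * L l) := by
      field_simp
      ring
    have hb : mmfBound₂ L l = 1 - (∑ i, L i) /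
        (((n : ℝ) - (l : ℕ) + 1 - 0) * (headSum L l + 0 * L l)) := by
      rw [mmfBound₂, sub_zero, zero_mul, add_zero]
    rw [hval] at hG
    exact ⟨l, ⟨⟨hl1, hlt⟩, hmin⟩, fun U hU p hp => hb ▸ isBilinearBound_le hpos hG hU hp,
      hb ▸ exists_isPriceOfMMF_eq hpos l hl1 le_rfl one_pos hG⟩
  · have hc : ∀ i, L i = L 0 := fun i => heq i 0
    have hhead : ∀ l : Fin n, headSum L l = (l : ℕ) * L 0 := fun l => by
      rw [headSum, Finset.sum_congr rfl fun i _ => hc i]; simp [card_filter_lt]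
    have h0 := hpos 0
    -- For equal utilities `indexSet₁` reads `n - 1 < 2 l ≤ n + 1`.
    obtain ⟨l, hl⟩ := hgreatest ⟨⟨(n + 1) / 2, by omega⟩, by simp; omega, by
      rw [hhead, hc ⟨(n + 1) / 2, _⟩]
      refine mul_lt_mul_of_pos_right ?_ h0
      have : (n : ℝ) < 2 * ((n + 1) / 2 : ℕ) + 1 := by
        exact_mod_cast (by omega : n < 2 * ((n + 1) / 2) + 1)
      simp only; linarith, by
      rw [hhead, hc ⟨(n + 1) / 2, _⟩]
      refine mul_le_mul_of_nonneg_right ?_ h0.le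
      have : 2 * (((n + 1) / 2 : ℕ) : ℝ) ≤ n + 1 := by
        exact_mod_cast (by omega : 2 * ((n + 1) / 2) ≤ n + 1)
      simp only; linarith⟩
    refine ⟨l, hl, ?_⟩
    rw [mmfBound₁, hhead, hc l, Finset.sum_congr rfl fun i _ => hc i]
    have hn0 : (n : ℝ) + 1 ≠ 0 := by positivity
    -- The index `l` cancels, so its exact value is not needed.
    rw [show (l : ℕ) * L 0 + ((n : ℝ) - (l : ℕ) + 1) * L 0 = (n + 1) * L 0 by ring]
    simp only [Finset.sum_const, Finset.card_univ, Fintype.card_fin, nsmul_eq_mul]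
    field_simp
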